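/- **Theorem (KL-closure theorem).** For a finite simple graph $G$ let $I(G;x)=\sum_{j=0}^{\alpha(G)} s_j(G)x^j$ be its independence polynomial, where $s_j(G)$ is the number of independent sets of $G$ of size $j$ and $\alpha(G)$ is the independence number. A polynomial $\sum_{j=0}^{d}a_jx^j$ of degree $d$ with nonnegative coefficients is *unimodal* if $a_0\le\dots\le a_m\ge\dots\ge a_d$ for some $0\le m\le d$, and *log-concave* if $a_i^2\ge a_{i-1}a_{i+1}$ for all $1\le i\le d-1$; the inequality with $i=d-1$ is the *penultimate* one. For integers $m,n\ge 1$ let $T_{3,m,n}$ be the tree with root $v_0$ adjacent to $v_1,v_2,v_3$, in which $v_1$ carries three paths $v_1a_{1,j}b_{1,j}$ ($1\le j\le 3$), $v_2$ carries $m$ paths $v_2a_{2,j}b_{2,j}$ ($1\le j\le m$), and $v_3$ carries $n$ paths $v_3a_{3,j}b_{3,j}$ ($1\le j\le n$). All the vertices named are distinct and there are no further vertices or edges. For integers $k\ge 1$ and $r\ge 0$ let $U_{k,r}$ be the graph obtained from $T_{3,k,k+r}$ by adding the edge $v_1a_{2,1}$. Then, if $r\in\{0,1\}$ and $k\ge 3$,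 or if $r=2$ and $k\ge 4$, the independence polynomial $I(U_{k,r};x)$ is unimodal but not log-concave. In each case the penultimate log-concavity inequality fails: with $d=\deg I(U_{k,r};x)=\alpha(U_{k,r})$ and $I(U_{k,r};x)=\sum_{j=0}^d u_jx^j$, one has $u_{d-1}^2<u_{d-2}u_d$. -/

import Mathlib

open Polynomial

/-- The independence polynomial `I(G; x) = ∑_{k = 0}^{α(G)} s_k(G) x^k` of a finite simple graph,
where `s_k(G)` is the number of independent sets of size `k`. -/
noncomputable def indepPoly {V : Type*} [Fintype V] (G : SimpleGraph V) : ℕ[X] :=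
  ∑ k ∈ Finset.range (G.indepNum + 1), monomial k {s : Finset V | G.IsNIndepSet k s}.ncard

/-- The coefficient sequence `a_0, …, a_d` (`d` the degree) rises to a peak and then falls. -/
def UnimodalPoly (p : ℕ[X]) : Prop :=
  ∃ m ≤ p.natDegree, (∀ i < m, p.coeff i ≤ p.coeff (i + 1)) ∧
    ∀ i, m ≤ i → i < p.natDegree → p.coeff (i + 1) ≤ p.coeff i

/-- The coefficient sequence `a_0, …, a_d` (`d` the degree) satisfies
`a_{i-1} a_{i+1} ≤ a_i ^ 2` for `1 ≤ i ≤ d - 1`. -/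
def LogConcavePoly (p : ℕ[X]) : Prop :=
  ∀ i, 1 ≤ i → i + 1 ≤ p.natDegree → p.coeff (i - 1) * p.coeff (i + 1) ≤ p.coeff i ^ 2

/-- The log-concavity inequality at the penultimate index `i = d - 1` exists and fails. -/
def PenultimateFails (p : ℕ[X]) : Prop :=
  ∃ i, 1 ≤ i ∧ i + 1 = p.natDegree ∧ p.coeff i ^ 2 < p.coeff (i - 1) * p.coeff (i + 1)

/-- Vertices of the Kadrawi–Levit tree `T_{3,m,n}`. The arms are numbered from `0`. -/
inductive KLVertex (m n : ℕ) : Type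
  | v0 : KLVertex m n
  | v1 : KLVertex m n
  | v2 : KLVertex m n
  | v3 : KLVertex m n
  | a1 (j : Fin 3) : KLVertex m n
  | b1 (j : Fin 3) : KLVertex m n
  | a2 (j : Fin m) : KLVertex m n
  | b2 (j : Fin m) : KLVertex m n
  | a3 (j : Fin n) : KLVertex m n
  | b3 (j : Fin n) : KLVertex m n
deriving DecidableEq, Fintype

/-- The edges of `T_{3,m,n}`, directed away from the root. -/
inductive KLEdge (m n : ℕ) : KLVertex m n → KLVertex m n → Prop
  | v0v1 : KLEdge m n .v0 .v1
  | v0v2 : KLEdge m n .v0 .v2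
  | v0v3 : KLEdge m n .v0 .v3
  | v1a1 (j : Fin 3) : KLEdge m n .v1 (.a1 j)
  | a1b1 (j : Fin 3) : KLEdge m n (.a1 j) (.b1 j)
  | v2a2 (j : Fin m) : KLEdge m n .v2 (.a2 j)
  | a2b2 (j : Fin m) : KLEdge m n (.a2 j) (.b2 j)
  | v3a3 (j : Fin n) : KLEdge m n .v3 (.a3 j)
  | a3b3 (j : Fin n) : KLEdge m n (.a3 j) (.b3 j)

/-- The Kadrawi–Levit tree `T_{3,m,n}`. -/
def KLTree (m n : ℕ) : SimpleGraph (KLVertex m n) :=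
  SimpleGraph.fromRel (KLEdge m n)

/-- The graph `U_{m,n}` obtained from `T_{3,m,n}` (`m ≥ 1`) by adding the edge between `v1` and
the inner vertex of the first arm at `v2`. -/
def KLClosure (m n : ℕ) (hm : 1 ≤ m) : SimpleGraph (KLVertex m n) :=
  KLTree m n ⊔ SimpleGraph.edge .v1 (.a2 ⟨0, hm⟩)

/-! Put `k = m + 1`, `n = m + 1 + r`, `N = m + n + 4`. Conditioning on whether `v0`, or else `v1`,
is chosen (`indepPoly_klClosure`) splits the polynomial into three summands built from `1 + X`, `1 +
2X` and `armPoly`; the added edge only turns one arm factor `1 + 2X` into `1 + X` when `v1` is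
chosen.

Penultimate failure: the top coefficient is 1, the next is about `2^m + 2^n`, and the one before is
at least `2^(m+n+4)`, the leading coefficient of the first summand. For `r ≤ 2` this beats the
square, since `(1 + 2^(r+1))^2 < 2^(r+5)`.

Unimodality: every factor is log-concave without internal zeros, and this passes to products
(`IsPF2.mul`), so each summand is unimodal. A sum of unimodal sequences is unimodal if all modes lie
in a common pair `{p, p + 1}` (`UnimodalPoly.of_peak`). Here `p` is the integer part of `(2N +
1)/3`, a mode of `(1 + 2X)^N`. The first summand is this power shifted by `X`. The others are a
power of `1 + 2X`, with factor `1` or `X(1 + X)^4`, plus a remainder whose coefficient sum is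
exponentially smaller than `3^N`. Near the mode consecutive coefficients of the main term differ by
at least a multiple of `3^N/(N + 1)^2`, which absorbs the remainder when `m ≥ 27`. The finitely many
smaller cases are computed. -/

/-! ### Closed form of the independence polynomial -/

/-- The independence polynomial as a sum over indicator functions of independent sets. -/
theorem indepPoly_eq_sum {V : Type*} [Fintype V] [DecidableEq V] (G : SimpleGraph V)
    (P : (V → Bool) → Prop) [DecidablePred P]
    (hP : ∀ f, P f ↔ ∀ u v, G.Adj u v → ¬ (f u = true ∧ f v = true)) :
    indepPoly G = ∑ f : V → Bool, if P f then ∏ v, (if f v then (X : ℕ[X]) else 1) else 0 := by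
  classical
  have hset : ∀ f : V → Bool, P f ↔ G.IsIndepSet (Finset.univ.filter fun v => f v = true) := by
    intro f
    rw [hP]
    constructor
    · intro h u hu v hv _ hadj
      exact h u v hadj ⟨by simpa using hu, by simpa using hv⟩
    · intro h u v hadj huv
      exact h (by simpa using huv.1) (by simpa using huv.2) hadj.ne hadj
  have h1 : (∑ f : V → Bool, if P f then ∏ v, (if f v then (X : ℕ[X]) else 1) else 0)
      = ∑ s : Finset V, if G.IsIndepSet s then (X : ℕ[X]) ^ s.card else 0 := by
    refine Finset.sum_bij' (fun f _ => Finset.univ.filter fun v => f v = true)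
      (fun s _ v => decide (v ∈ s)) (by simp) (by simp) ?_ ?_ ?_
    · intro f _; ext v; simp
    · intro s _; ext v; simp
    · intro f _
      rw [if_congr (hset f) rfl rfl]
      congr 1
      rw [← Finset.prod_filter, Finset.prod_const]
  rw [h1, indepPoly]
  have h2 : ∀ s : Finset V, (if G.IsIndepSet s then (X : ℕ[X]) ^ s.card else 0)
      = ∑ k ∈ Finset.range (G.indepNum + 1), if G.IsNIndepSet k s then (X : ℕ[X]) ^ k else 0 := by
    intro s
    split_ifs with hs
    · rw [Finset.sum_eq_single s.card]
      · rw [if_pos ⟨hs, rfl⟩]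
      · intro k _ hk
        rw [if_neg]
        intro h
        exact hk h.card_eq.symm
      · intro h
        exact absurd (Finset.mem_range.2 (Nat.lt_succ_of_le hs.card_le_indepNum)) h
    · symm
      apply Finset.sum_eq_zero
      intro k _
      rw [if_neg]
      intro h
      exact hs h.isIndepSet
  simp_rw [h2]
  rw [Finset.sum_comm]
  refine Finset.sum_congr rfl fun k _ => ?_
  rw [← Finset.sum_filter, Finset.sum_const, Set.ncard_eq_toFinset_card', nsmul_eq_mul,
    ← C_mul_X_pow_eq_monomial]
  simp

/-- Splitting the vertices of `T_{3,m,n}` into the four centres and the three families of arms. -/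
def klVertexEquiv (m n : ℕ) : KLVertex m n ≃
    (Unit ⊕ Unit ⊕ Unit ⊕ Unit) ⊕ (Fin 3 ⊕ Fin 3) ⊕ (Fin m ⊕ Fin m) ⊕ (Fin n ⊕ Fin n) where
  toFun
    | .v0 => .inl (.inl ())
    | .v1 => .inl (.inr (.inl ()))
    | .v2 => .inl (.inr (.inr (.inl ())))
    | .v3 => .inl (.inr (.inr (.inr ())))
    | .a1 j => .inr (.inl (.inl j))
    | .b1 j => .inr (.inl (.inr j))
    | .a2 j => .inr (.inr (.inl (.inl j)))
    | .b2 j => .inr (.inr (.inl (.inr j)))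
    | .a3 j => .inr (.inr (.inr (.inl j)))
    | .b3 j => .inr (.inr (.inr (.inr j)))
  invFun
    | .inl (.inl ()) => .v0
    | .inl (.inr (.inl ())) => .v1
    | .inl (.inr (.inr (.inl ()))) => .v2
    | .inl (.inr (.inr (.inr ()))) => .v3
    | .inr (.inl (.inl j)) => .a1 j
    | .inr (.inl (.inr j)) => .b1 j
    | .inr (.inr (.inl (.inl j))) => .a2 j
    | .inr (.inr (.inl (.inr j))) => .b2 j
    | .inr (.inr (.inr (.inl j))) => .a3 j
    | .inr (.inr (.inr (.inr j))) => .b3 j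
  left_inv v := by cases v <;> rfl
  right_inv v := by rcases v with (_ | _ | _ | _) | (_ | _) | (_ | _) | (_ | _) <;> rfl

theorem prod_klVertex {M : Type*} [CommMonoid M] {m n : ℕ} (g : KLVertex m n → M) :
    ∏ v, g v = (g .v0 * (g .v1 * (g .v2 * g .v3))) *
      ((∏ j, g (.a1 j) * g (.b1 j)) *
        ((∏ j, g (.a2 j) * g (.b2 j)) * ∏ j, g (.a3 j) * g (.b3 j))) := by
  rw [← (klVertexEquiv m n).symm.prod_comp]
  simp only [Fintype.prod_sum_type, Finset.prod_mul_distrib, Finset.univ_unique,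
    Finset.prod_singleton]
  rfl

/-- A vertex indicator on `T_{3,m,n}` is a choice at each centre and on each arm. -/
def klIndicatorEquiv (m n : ℕ) :
    ((Bool × Bool × Bool × Bool) × (Fin 3 → Bool × Bool) × (Fin m → Bool × Bool) ×
      (Fin n → Bool × Bool)) ≃ (KLVertex m n → Bool) where
  toFun t
    | .v0 => t.1.1
    | .v1 => t.1.2.1
    | .v2 => t.1.2.2.1
    | .v3 => t.1.2.2.2
    | .a1 j => (t.2.1 j).1
    | .b1 j => (t.2.1 j).2
    | .a2 j => (t.2.2.1 j).1
    | .b2 j => (t.2.2.1 j).2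
    | .a3 j => (t.2.2.2 j).1
    | .b3 j => (t.2.2.2 j).2
  invFun f := ((f .v0, f .v1, f .v2, f .v3), (fun j => (f (.a1 j), f (.b1 j))),
    (fun j => (f (.a2 j), f (.b2 j))), (fun j => (f (.a3 j), f (.b3 j))))
  left_inv _ := rfl
  right_inv f := by funext v; cases v <;> rfl

/-- The weight of a pair of adjacent choices: `0` if both endpoints are chosen. -/
noncomputable def pairWeight (a b : Bool) : ℕ[X] := if a && b then 0 else 1

/-- The weight `x` of a chosen vertex. -/
noncomputable def vertexWeight (a : Bool) : ℕ[X] := if a then X else 1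

/-- The weight of an arm `v a b` with the choice at its centre `v` given. -/
noncomputable def armWeight (v : Bool) (t : Bool × Bool) : ℕ[X] :=
  pairWeight v t.1 * pairWeight t.1 t.2 * (vertexWeight t.1 * vertexWeight t.2)

theorem prod_pairWeight {ι : Type*} [Fintype ι] (f g : ι → Bool) :
    ∏ j, pairWeight (f j) (g j) = if ∀ j, ¬ (f j = true ∧ g j = true) then 1 else 0 := by
  classical
  unfold pairWeight
  split_ifs with h
  · apply Finset.prod_eq_one
    intro j _
    rw [if_neg]
    simpa using h j
  · push Not at h
    obtain ⟨j, hj⟩ := h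
    apply Finset.prod_eq_zero (Finset.mem_univ j)
    simp [hj]

theorem klClosure_indep_iff {m n : ℕ} (hm : 1 ≤ m) (f : KLVertex m n → Bool) :
    (∀ u v, (KLClosure m n hm).Adj u v → ¬ (f u = true ∧ f v = true)) ↔
      (((¬ (f .v0 = true ∧ f .v1 = true) ∧ ¬ (f .v0 = true ∧ f .v2 = true)) ∧
        ¬ (f .v0 = true ∧ f .v3 = true)) ∧ ¬ (f .v1 = true ∧ f (.a2 ⟨0, hm⟩) = true)) ∧
      ((∀ j, ¬ (f .v1 = true ∧ f (.a1 j) = true)) ∧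
        (∀ j, ¬ (f (.a1 j) = true ∧ f (.b1 j) = true))) ∧
      ((∀ j, ¬ (f .v2 = true ∧ f (.a2 j) = true)) ∧
        (∀ j, ¬ (f (.a2 j) = true ∧ f (.b2 j) = true))) ∧
      ((∀ j, ¬ (f .v3 = true ∧ f (.a3 j) = true)) ∧
        (∀ j, ¬ (f (.a3 j) = true ∧ f (.b3 j) = true))) := by
  constructor
  · intro h
    have key : ∀ {u v}, KLEdge m n u v → ¬ (f u = true ∧ f v = true) := by
      intro u v e
      apply h
      left
      rw [KLTree, SimpleGraph.fromRel_adj]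
      exact ⟨by cases e <;> simp, Or.inl e⟩
    refine ⟨⟨⟨⟨key .v0v1, key .v0v2⟩, key .v0v3⟩, ?_⟩,
      ⟨fun j => key (.v1a1 j), fun j => key (.a1b1 j)⟩,
      ⟨fun j => key (.v2a2 j), fun j => key (.a2b2 j)⟩,
      ⟨fun j => key (.v3a3 j), fun j => key (.a3b3 j)⟩⟩
    apply h
    right
    simp [SimpleGraph.edge_adj]
  · rintro ⟨⟨⟨⟨h1, h2⟩, h3⟩, h4⟩, ⟨h5, h6⟩, ⟨h7, h8⟩, ⟨h9, h10⟩⟩ u v hadj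
    have key : ∀ {u v}, KLEdge m n u v → ¬ (f u = true ∧ f v = true) := by
      intro u v e
      cases e <;> solve_by_elim
    rcases hadj with hadj | hadj
    · rw [KLTree, SimpleGraph.fromRel_adj] at hadj
      rcases hadj.2 with e | e
      · exact key e
      · exact fun hh => key e hh.symm
    · rw [SimpleGraph.edge_adj] at hadj
      rcases hadj.1 with ⟨rfl, rfl⟩ | ⟨rfl, rfl⟩
      · exact h4
      · exact fun hh => h4 hh.symm

theorem sum_armWeight (v : Bool) :
    ∑ t, armWeight v t = if v then (1 + X : ℕ[X]) else 1 + 2 * X := by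
  cases v <;> simp [Fintype.sum_prod_type, armWeight, pairWeight, vertexWeight] <;> ring

theorem sum_prod_armWeight (v : Bool) (n : ℕ) :
    ∑ f : Fin n → Bool × Bool, ∏ j, armWeight v (f j) =
      (if v then (1 + X : ℕ[X]) else 1 + 2 * X) ^ n := by
  have h := Finset.prod_univ_sum (fun _ : Fin n => (Finset.univ : Finset (Bool × Bool)))
    (fun _ t => armWeight v t)
  rw [Fintype.piFinset_univ] at h
  rw [← h, sum_armWeight]
  simp

theorem sum_pairWeight_mul_armWeight (u v : Bool) :
    ∑ t : Bool × Bool, pairWeight u t.1 * armWeight v t =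
      if u || v then (1 + X : ℕ[X]) else 1 + 2 * X := by
  cases u <;> cases v <;>
    simp [Fintype.sum_prod_type, armWeight, pairWeight, vertexWeight] <;> ring

/-- Here `u` stands for `v1`, which through the added edge sees only arm `0`. Attaching its weight
to that arm keeps the summand a product over arms, so the sum still factors. -/
theorem sum_pairWeight_mul_prod_armWeight (u v : Bool) (m : ℕ) :
    ∑ f : Fin (m + 1) → Bool × Bool, pairWeight u (f 0).1 * ∏ j, armWeight v (f j) =
      (if u || v then (1 + X : ℕ[X]) else 1 + 2 * X) *
        (if v then (1 + X : ℕ[X]) else 1 + 2 * X) ^ m := by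
  have h := Finset.prod_univ_sum (fun _ : Fin (m + 1) => (Finset.univ : Finset (Bool × Bool)))
    (fun j t => if j = 0 then pairWeight u t.1 * armWeight v t else armWeight v t)
  rw [Fintype.piFinset_univ] at h
  simp only [Fin.prod_univ_succ, if_true, Fin.succ_ne_zero, if_false, sum_armWeight,
    sum_pairWeight_mul_armWeight] at h
  simp only [Fin.prod_univ_succ, ← mul_assoc] at h ⊢
  rw [← h]
  simp

/-- The independence polynomial of a centre carrying `n` arms of length two. -/
noncomputable def armPoly (n : ℕ) : ℕ[X] := (1 + 2 * X) ^ n + X * (1 + X) ^ n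

theorem ite_indep_prod_eq {m n : ℕ} (f : KLVertex (m + 1) n → Bool) :
    (if (((¬ (f .v0 = true ∧ f .v1 = true) ∧ ¬ (f .v0 = true ∧ f .v2 = true)) ∧
        ¬ (f .v0 = true ∧ f .v3 = true)) ∧ ¬ (f .v1 = true ∧ f (.a2 0) = true)) ∧
      ((∀ j, ¬ (f .v1 = true ∧ f (.a1 j) = true)) ∧
        (∀ j, ¬ (f (.a1 j) = true ∧ f (.b1 j) = true))) ∧
      ((∀ j, ¬ (f .v2 = true ∧ f (.a2 j) = true)) ∧
        (∀ j, ¬ (f (.a2 j) = true ∧ f (.b2 j) = true))) ∧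
      ((∀ j, ¬ (f .v3 = true ∧ f (.a3 j) = true)) ∧
        (∀ j, ¬ (f (.a3 j) = true ∧ f (.b3 j) = true)))
      then ∏ v, (if f v then (X : ℕ[X]) else 1) else 0) =
      (pairWeight (f .v0) (f .v1) * pairWeight (f .v0) (f .v2) * pairWeight (f .v0) (f .v3) *
        (vertexWeight (f .v0) * (vertexWeight (f .v1) *
          (vertexWeight (f .v2) * vertexWeight (f .v3))))) *
      ((∏ j, armWeight (f .v1) (f (.a1 j), f (.b1 j))) *
      ((pairWeight (f .v1) (f (.a2 0)) * ∏ j, armWeight (f .v2) (f (.a2 j), f (.b2 j))) *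
        ∏ j, armWeight (f .v3) (f (.a3 j), f (.b3 j)))) := by
  have hp : ∀ a b : Bool, pairWeight a b = if ¬ (a = true ∧ b = true) then 1 else 0 := by
    intro a b; cases a <;> cases b <;> rfl
  have hite : ∀ (p q : Prop) [Decidable p] [Decidable q],
      (if p ∧ q then (1 : ℕ[X]) else 0) = (if p then 1 else 0) * (if q then 1 else 0) := by
    intro p q _ _; by_cases p <;> by_cases q <;> simp [*]
  have hmul : ∀ (p : Prop) [Decidable p] (y : ℕ[X]),
      (if p then y else 0) = (if p then 1 else 0) * y := by
    intro p _ y; by_cases p <;> simp [*]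
  have hv : ∀ a : Bool, (if a = true then (X : ℕ[X]) else 1) = vertexWeight a := fun _ => rfl
  rw [hmul, prod_klVertex]
  simp only [hite, ← hp, prod_pairWeight, armWeight, Finset.prod_mul_distrib, hv]
  ring_nf

theorem indepPoly_klClosure (m n : ℕ) (hm : 1 ≤ m + 1) :
    indepPoly (KLClosure (m + 1) n hm) =
      X * (1 + 2 * X) ^ (m + n + 4) + (1 + 2 * X) ^ 3 * (armPoly (m + 1) * armPoly n) +
        X * ((1 + X) ^ 4 * (armPoly m * armPoly n)) := by
  rw [indepPoly_eq_sum _ _ fun f => (klClosure_indep_iff hm f).symm]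
  have h0 : (⟨0, hm⟩ : Fin (m + 1)) = 0 := rfl
  simp only [h0]
  rw [Finset.sum_congr rfl fun f _ => ite_indep_prod_eq f,
    ← (klIndicatorEquiv (m + 1) n).sum_comp, Fintype.sum_prod_type]
  simp only [klIndicatorEquiv, Equiv.coe_fn_mk, ← Finset.mul_sum]
  simp only [Fintype.sum_prod_type, ← Finset.mul_sum, ← Finset.sum_mul, sum_prod_armWeight,
    sum_pairWeight_mul_prod_armWeight, Prod.mk.eta]
  simp [pairWeight, vertexWeight, armPoly]
  ring

/-! ### Log-concavity without internal zeros, and its closure under products -/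

/-- The coefficient sequence is a Pólya frequency sequence of order two:
nonnegative, log-concave and without internal zeros. -/
def IsPF2 (p : ℕ[X]) : Prop :=
  ∀ i j k l, i ≤ j → i ≤ k → i + l = j + k → p.coeff i * p.coeff l ≤ p.coeff j * p.coeff k

/-- The coefficients of a polynomial, extended by zero to negative indices. -/
def intCoeff (p : ℕ[X]) (t : ℤ) : ℤ := if 0 ≤ t then (p.coeff t.toNat : ℤ) else 0

theorem intCoeff_natCast (p : ℕ[X]) (i : ℕ) : intCoeff p i = p.coeff i := by
  simp [intCoeff]

theorem intCoeff_of_neg (p : ℕ[X]) {t : ℤ} (h : t < 0) : intCoeff p t = 0 := by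
  simp [intCoeff, h]

theorem intCoeff_nonneg (p : ℕ[X]) (t : ℤ) : 0 ≤ intCoeff p t := by
  unfold intCoeff
  split_ifs <;> positivity

theorem IsPF2.intCoeff_mul_le {p : ℕ[X]} (hp : IsPF2 p) {i j k l : ℤ} (hij : i ≤ j) (hik : i ≤ k)
    (h : i + l = j + k) : intCoeff p i * intCoeff p l ≤ intCoeff p j * intCoeff p k := by
  rcases lt_or_ge i 0 with hi | hi
  · rw [intCoeff_of_neg p hi, zero_mul]
    exact mul_nonneg (intCoeff_nonneg _ _) (intCoeff_nonneg _ _)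
  · lift i to ℕ using hi
    lift j to ℕ using by omega
    lift k to ℕ using by omega
    lift l to ℕ using by omega
    simp only [intCoeff_natCast]
    exact_mod_cast hp i j k l (by omega) (by omega) (by omega)

/-- Zero extension allows a shifted convolution index and a longer range. The four coefficients
compared in `IsPF2.mul` thereby become sums over one common index set. -/
theorem intCoeff_mul_eq_sum (p q : ℕ[X]) (k L : ℕ) (h : ℕ) (hL : k + h ≤ L) :
    intCoeff (p * q) k =
      ∑ κ ∈ Finset.range (L + 1), intCoeff p ((k + h : ℕ) - κ) * intCoeff q (κ - h) := by
  rw [intCoeff_natCast, coeff_mul, Finset.Nat.sum_antidiagonal_eq_sum_range_succ_mk]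
  simp only [Nat.succ_eq_add_one]
  push_cast
  rw [← Finset.sum_range_reflect]
  have h1 : ∑ κ ∈ Finset.range (L + 1), intCoeff p ((k : ℤ) + h - κ) * intCoeff q (κ - h)
      = ∑ κ ∈ Finset.Ico h (h + (k + 1)), intCoeff p ((k : ℤ) + h - κ) * intCoeff q (κ - h) := by
    symm
    apply Finset.sum_subset
    · intro κ; simp only [Finset.mem_Ico, Finset.mem_range]; omega
    · intro κ _ hκ
      simp only [Finset.mem_Ico] at hκ
      rcases lt_or_ge κ h with h2 | h2
      · rw [intCoeff_of_neg q (by omega), mul_zero]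
      · rw [intCoeff_of_neg p (by omega), zero_mul]
  rw [h1, Finset.sum_Ico_eq_sum_range]
  simp only [Nat.add_sub_cancel_left]
  refine Finset.sum_congr rfl fun j hj => ?_
  rw [Finset.mem_range] at hj
  have e1 : ((k : ℤ) + h - (h + j : ℕ)) = ((k - j : ℕ) : ℤ) := by omega
  have e2 : (((h + j : ℕ) : ℤ) - h) = ((j : ℕ) : ℤ) := by omega
  rw [e1, e2, intCoeff_natCast, intCoeff_natCast]
  congr 3; omega

/-- Cauchy–Binet for two rows: the difference of the two sides is half the double sum of products of
2×2 minors, and the two minors in each product have the same sign. -/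
theorem sum_mul_sum_le_of_minors {ι : Type*} [LinearOrder ι] (s : Finset ι) (x y u v : ι → ℤ)
    (hxy : ∀ k l, k < l → x k * y l ≤ x l * y k) (huv : ∀ k l, k < l → v k * u l ≤ u k * v l) :
    (∑ k ∈ s, y k * v k) * (∑ k ∈ s, x k * u k) ≤
      (∑ k ∈ s, y k * u k) * (∑ k ∈ s, x k * v k) := by
  have h1 : 2 * ((∑ k ∈ s, y k * u k) * (∑ k ∈ s, x k * v k) -
      (∑ k ∈ s, y k * v k) * (∑ k ∈ s, x k * u k)) =
      ∑ k ∈ s, ∑ l ∈ s, (x l * y k - x k * y l) * (u k * v l - v k * u l) := by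
    have e : ∑ k ∈ s, ∑ l ∈ s, (x l * y k - x k * y l) * (u k * v l - v k * u l) =
        ∑ k ∈ s, ∑ l ∈ s, ((y k * u k) * (x l * v l) - (y k * v k) * (x l * u l)
          - (x k * u k) * (y l * v l) + (x k * v k) * (y l * u l)) := by
      refine Finset.sum_congr rfl fun k _ => Finset.sum_congr rfl fun l _ => by ring
    rw [e]
    simp only [Finset.sum_add_distrib, Finset.sum_sub_distrib, ← Finset.mul_sum, ← Finset.sum_mul]
    ring
  have h2 : 0 ≤ ∑ k ∈ s, ∑ l ∈ s, (x l * y k - x k * y l) * (u k * v l - v k * u l) := by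
    refine Finset.sum_nonneg fun k _ => Finset.sum_nonneg fun l _ => ?_
    rcases lt_trichotomy k l with h | rfl | h
    · exact mul_nonneg (sub_nonneg.2 (hxy k l h)) (sub_nonneg.2 (huv k l h))
    · simp [mul_comm]
    · refine mul_nonneg_of_nonpos_of_nonpos ?_ ?_
      · linarith [hxy l k h]
      · linarith [huv l k h, mul_comm (v k) (u l), mul_comm (u k) (v l)]
  linarith

theorem IsPF2.mul {p q : ℕ[X]} (hp : IsPF2 p) (hq : IsPF2 q) : IsPF2 (p * q) := by
  intro i j k l hij hik h
  obtain ⟨d, rfl⟩ : ∃ d, l = k + d := ⟨l - k, by omega⟩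
  have hj : j = i + d := by omega
  -- The rows are shifts of `p` by `k + d` and `i + d`, the columns shifts of `q` by `0` and `d`;
  -- the four pairings give the coefficients at `l`, `k`, `j` and `i`.
  have key := sum_mul_sum_le_of_minors (Finset.range (k + d + 1))
    (fun κ : ℕ => intCoeff p ((k + d : ℕ) - κ)) (fun κ : ℕ => intCoeff p ((i + d : ℕ) - κ))
    (fun κ : ℕ => intCoeff q (κ - (0 : ℕ))) (fun κ : ℕ => intCoeff q (κ - d)) ?_ ?_
  · rw [← intCoeff_mul_eq_sum p q i (k + d) d (by omega),
      ← intCoeff_mul_eq_sum p q k (k + d) d (by omega)] at key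
    have e1 := intCoeff_mul_eq_sum p q (k + d) (k + d) 0 (by omega)
    have e2 := intCoeff_mul_eq_sum p q (i + d) (k + d) 0 (by omega)
    rw [add_zero] at e1 e2
    rw [← e1, ← e2] at key
    simp only [intCoeff_natCast] at key
    rw [hj]
    exact_mod_cast key
  · intro κ μ hκ
    have := hp.intCoeff_mul_le (i := (i + d : ℕ) - μ) (l := (k + d : ℕ) - κ)
      (j := (k + d : ℕ) - μ) (k := (i + d : ℕ) - κ) (by omega) (by omega) (by omega)
    linarith [mul_comm (intCoeff p ((i + d : ℕ) - μ)) (intCoeff p ((k + d : ℕ) - κ))]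
  · intro κ μ hκ
    exact hq.intCoeff_mul_le (by omega) (by omega) (by omega)

theorem IsPF2.of_sq {p : ℕ[X]} (hz : ∀ i j, i ≤ j → p.coeff i = 0 → p.coeff j = 0)
    (h : ∀ i, p.coeff i * p.coeff (i + 2) ≤ p.coeff (i + 1) ^ 2) : IsPF2 p := by
  have step : ∀ i d, p.coeff i * p.coeff (i + d + 2) ≤ p.coeff (i + 1) * p.coeff (i + d + 1) := by
    intro i d
    induction d with
    | zero => simpa [sq] using h i
    | succ d ih =>
      -- Lengthening the interval divides by this middle coefficient; if it vanishes, so does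
      -- everything after it.
      rcases Nat.eq_zero_or_pos (p.coeff (i + d + 1)) with h0 | hpos
      · rw [show i + (d + 1) + 2 = i + d + 3 by ring, hz _ (i + d + 3) (by omega) h0]
        simp
      · have h2 := h (i + d + 1)
        rw [show i + (d + 1) + 2 = i + d + 3 by ring, show i + (d + 1) + 1 = i + d + 2 by ring]
        rw [show i + d + 1 + 2 = i + d + 3 by ring, show i + d + 1 + 1 = i + d + 2 by ring] at h2
        refine Nat.le_of_mul_le_mul_left ?_ hpos
        calc p.coeff (i + d + 1) * (p.coeff i * p.coeff (i + d + 3))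
            = p.coeff i * (p.coeff (i + d + 1) * p.coeff (i + d + 3)) := by ring
          _ ≤ p.coeff i * p.coeff (i + d + 2) ^ 2 := Nat.mul_le_mul_left _ h2
          _ = p.coeff i * p.coeff (i + d + 2) * p.coeff (i + d + 2) := by ring
          _ ≤ p.coeff (i + 1) * p.coeff (i + d + 1) * p.coeff (i + d + 2) :=
            Nat.mul_le_mul_right _ ih
          _ = _ := by ring
  have wide : ∀ t i d, p.coeff i * p.coeff (i + d + 2 * t) ≤ p.coeff (i + t) * p.coeff (i + d + t) := by
    intro t
    induction t with
    | zero => intro i d; simp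
    | succ t ih =>
      intro i d
      have h1 := step i (d + 2 * t)
      have h2 := ih (i + 1) d
      rw [show i + (d + 2 * t) + 2 = i + d + 2 * (t + 1) by ring] at h1
      rw [show i + 1 + d + 2 * t = i + (d + 2 * t) + 1 by ring,
        show i + 1 + t = i + (t + 1) by ring, show i + 1 + d + t = i + d + (t + 1) by ring] at h2
      exact h1.trans h2
  intro i j k l hij hik he
  rcases le_total j k with hjk | hjk
  · obtain ⟨t, rfl⟩ := Nat.exists_eq_add_of_le hij
    obtain ⟨d, rfl⟩ := Nat.exists_eq_add_of_le hjk
    have := wide t i d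
    rw [show l = i + d + 2 * t by omega, show i + t + d = i + d + t by ring]
    exact this
  · obtain ⟨t, rfl⟩ := Nat.exists_eq_add_of_le hik
    obtain ⟨d, rfl⟩ := Nat.exists_eq_add_of_le hjk
    have := wide t i d
    rw [show l = i + d + 2 * t by omega, show i + t + d = i + d + t by ring, mul_comm (p.coeff (i + d + t))]
    exact this

/-! ### Log-concavity of the factors -/

theorem coeff_one_add_two_mul_X_pow (n j : ℕ) :
    ((1 + 2 * X : ℕ[X]) ^ n).coeff j = n.choose j * 2 ^ j := by
  have h : (1 + 2 * X : ℕ[X]) ^ n = ((1 + X) ^ n).comp (C 2 * X) := by simp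
  rw [h, comp_C_mul_X_coeff, coeff_one_add_X_pow]
  simp

theorem IsPF2.one_add_two_mul_X : IsPF2 (1 + 2 * X) := by
  have hc : ∀ j, (1 + 2 * X : ℕ[X]).coeff j = (1 : ℕ).choose j * 2 ^ j := by
    intro j
    simpa using coeff_one_add_two_mul_X_pow 1 j
  refine IsPF2.of_sq ?_ ?_
  · intro i j hij
    simp only [hc, mul_eq_zero, Nat.choose_eq_zero_iff, pow_eq_zero_iff']
    omega
  · intro i
    rw [hc (i + 2), Nat.choose_eq_zero_of_lt (by omega)]
    simp

theorem IsPF2.one_add_X : IsPF2 (1 + X) := by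
  have hc : ∀ j, (1 + X : ℕ[X]).coeff j = (1 : ℕ).choose j := by
    intro j
    simpa using coeff_one_add_X_pow ℕ 1 j
  refine IsPF2.of_sq ?_ ?_
  · intro i j hij
    simp only [hc, Nat.choose_eq_zero_iff]
    omega
  · intro i
    rw [hc (i + 2), Nat.choose_eq_zero_of_lt (by omega)]
    simp

theorem IsPF2.one : IsPF2 1 := by
  refine IsPF2.of_sq ?_ ?_
  · intro i j hij
    simp only [coeff_one]
    split_ifs <;> simp; omega
  · intro i
    simp [coeff_one]

theorem IsPF2.pow {p : ℕ[X]} (hp : IsPF2 p) (n : ℕ) : IsPF2 (p ^ n) := by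
  induction n with
  | zero => simpa using IsPF2.one
  | succ n ih => rw [pow_succ]; exact ih.mul hp

/-- The leading zero puts `X * p` outside the scope of `IsPF2.of_sq`, so the shift is handled
directly. -/
theorem IsPF2.X_mul {p : ℕ[X]} (hp : IsPF2 p) : IsPF2 (X * p) := by
  intro i j k l hij hik h
  rcases i with _ | i
  · simp
  · obtain ⟨j, rfl⟩ := Nat.exists_eq_add_of_lt (show 0 < j by omega)
    obtain ⟨k, rfl⟩ := Nat.exists_eq_add_of_lt (show 0 < k by omega)
    obtain ⟨l, rfl⟩ := Nat.exists_eq_add_of_lt (show 0 < l by omega)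
    simp only [zero_add, coeff_X_mul]
    exact hp i j k l (by omega) (by omega) (by omega)

theorem coeff_armPoly_zero (n : ℕ) : (armPoly n).coeff 0 = 1 := by
  simp [armPoly, coeff_one_add_two_mul_X_pow]

theorem coeff_armPoly_succ (n j : ℕ) :
    (armPoly n).coeff (j + 1) = n.choose (j + 1) * 2 ^ (j + 1) + n.choose j := by
  simp [armPoly, coeff_one_add_two_mul_X_pow, coeff_X_mul, coeff_one_add_X_pow]

/-- A quantitative log-concavity of binomials. With `e = n - j - 1`, clearing the denominators `(j +
2)(e + 1)` by the ratios of neighbouring binomials reduces it to `(j + 2)(j + 1) ≤ 2^(j+2) (j + e +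
2)`. -/
theorem two_pow_mul_choose_defect (n j : ℕ) (hj : j + 1 ≤ n) :
    n.choose j * n.choose (j + 1) + 2 ^ (j + 2) * (n.choose j * n.choose (j + 2)) ≤
      2 ^ (j + 2) * n.choose (j + 1) ^ 2 := by
  obtain ⟨e, rfl⟩ := Nat.exists_eq_add_of_le hj
  have h1 := Nat.choose_succ_right_eq (j + 1 + e) j
  have h2 := Nat.choose_succ_right_eq (j + 1 + e) (j + 1)
  rw [show j + 1 + e - j = e + 1 by omega] at h1
  rw [show j + 1 + e - (j + 1) = e by omega] at h2
  set b := (j + 1 + e).choose j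
  set c := (j + 1 + e).choose (j + 1)
  set d := (j + 1 + e).choose (j + 2)
  have hpow : j + 2 < 2 ^ (j + 2) := Nat.lt_two_pow_self
  set P := 2 ^ (j + 2)
  have h2' : d * (j + 2) = c * e := h2
  refine Nat.le_of_mul_le_mul_left ?_ (show 0 < (j + 2) * (e + 1) by positivity)
  have e1 : (j + 2) * (e + 1) * (b * c + P * (b * d)) =
      (j + 2) * c * (b * (e + 1)) + P * ((b * (e + 1)) * (d * (j + 2))) := by ring
  rw [e1, ← h1, h2']
  have : (j + 2) * c * (c * (j + 1)) ≤ P * (j + e + 2) * c ^ 2 := by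
    calc (j + 2) * c * (c * (j + 1)) = (j + 2) * (j + 1) * c ^ 2 := by ring
      _ ≤ P * (j + e + 2) * c ^ 2 := by gcongr <;> omega
  calc _ ≤ P * (j + e + 2) * c ^ 2 + P * (c * (j + 1) * (c * e)) := by gcongr
    _ = _ := by ring

theorem choose_mul_choose_le (n j : ℕ) :
    n.choose j * n.choose (j + 2) ≤ n.choose (j + 1) ^ 2 := by
  rcases Nat.lt_or_ge n (j + 1) with h | h
  · simp [Nat.choose_eq_zero_of_lt (show n < j + 2 by omega)]
  · have := two_pow_mul_choose_defect n j h
    refine Nat.le_of_mul_le_mul_left ?_ (show 0 < 2 ^ (j + 2) by positivity)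
    omega

theorem choose_mul_choose_add_three_le (n j : ℕ) :
    n.choose j * n.choose (j + 3) ≤ n.choose (j + 1) * n.choose (j + 2) := by
  rcases Nat.eq_zero_or_pos (n.choose (j + 1)) with h0 | h0
  · rw [Nat.choose_eq_zero_iff] at h0
    simp [Nat.choose_eq_zero_of_lt (show n < j + 3 by omega)]
  rcases Nat.eq_zero_or_pos (n.choose (j + 2)) with h1 | h1
  · rw [Nat.choose_eq_zero_iff] at h1
    simp [Nat.choose_eq_zero_of_lt (show n < j + 3 by omega)]
  refine Nat.le_of_mul_le_mul_left ?_ (Nat.mul_pos h0 h1)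
  calc _ = (n.choose j * n.choose (j + 2)) * (n.choose (j + 1) * n.choose (j + 3)) := by ring
    _ ≤ n.choose (j + 1) ^ 2 * n.choose (j + 2) ^ 2 :=
      Nat.mul_le_mul (choose_mul_choose_le n j) (choose_mul_choose_le n (j + 1))
    _ = _ := by ring

/-- After expansion, `hac` and `had` absorb both terms containing `a`; the remaining cross term is
exactly what `two_pow_mul_choose_defect` pays for. The variable `a` stands for the binomial at `j -
1`, and is `0` at the boundary `j = 0`. -/
theorem armPoly_sq_aux (n j a : ℕ) (hac : a * n.choose (j + 1) ≤ n.choose j ^ 2)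
    (had : a * n.choose (j + 2) ≤ n.choose j * n.choose (j + 1)) :
    (n.choose j * 2 ^ j + a) * (n.choose (j + 2) * 2 ^ (j + 2) + n.choose (j + 1)) ≤
      (n.choose (j + 1) * 2 ^ (j + 1) + n.choose j) ^ 2 := by
  rcases Nat.lt_or_ge n (j + 1) with h | h
  · simp [Nat.choose_eq_zero_of_lt (show n < j + 2 by omega), Nat.choose_eq_zero_of_lt h]
  · have h1 := Nat.mul_le_mul_left (2 ^ j) (two_pow_mul_choose_defect n j h)
    have h2 := Nat.mul_le_mul_left (2 ^ (j + 2)) had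
    simp only [pow_add] at h1 h2 ⊢
    nlinarith [h1, h2, hac]

theorem isPF2_armPoly (n : ℕ) : IsPF2 (armPoly n) := by
  refine IsPF2.of_sq ?_ ?_
  · intro i j hij
    rcases i with _ | i
    · simp [coeff_armPoly_zero]
    · obtain ⟨j, rfl⟩ := Nat.exists_eq_add_of_lt (show 0 < j by omega)
      simp only [zero_add, coeff_armPoly_succ, Nat.add_eq_zero_iff, mul_eq_zero,
        Nat.choose_eq_zero_iff, pow_eq_zero_iff']
      omega
  · intro i
    rcases i with _ | i
    · have := armPoly_sq_aux n 0 0 (by simp) (by simp)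
      simpa [coeff_armPoly_zero, coeff_armPoly_succ] using this
    · have := armPoly_sq_aux n (i + 1) (n.choose i) (choose_mul_choose_le n i)
        (choose_mul_choose_add_three_le n i)
      simpa [coeff_armPoly_succ] using this

/-! ### Unimodality criterion, top coefficients and the penultimate inequality -/

/-- The step from `p` to `p + 1` is left free: whichever of the two coefficients is larger serves as
the peak. -/
theorem UnimodalPoly.of_peak {q : ℕ[X]} {p : ℕ} (hp : p + 1 ≤ q.natDegree)
    (hrise : ∀ i < p, q.coeff i ≤ q.coeff (i + 1))
    (hfall : ∀ i, p < i → q.coeff (i + 1) ≤ q.coeff i) : UnimodalPoly q := by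
  rcases le_total (q.coeff p) (q.coeff (p + 1)) with h | h
  · refine ⟨p + 1, hp, fun i hi => ?_, fun i hi _ => hfall i hi⟩
    rcases Nat.lt_succ_iff_lt_or_eq.1 hi with hi | rfl
    · exact hrise i hi
    · exact h
  · refine ⟨p, by omega, hrise, fun i hi _ => ?_⟩
    rcases Nat.lt_or_eq_of_le hi with hi | rfl
    · exact hfall i hi
    · exact h

theorem PenultimateFails.not_logConcavePoly {q : ℕ[X]} (h : PenultimateFails q) :
    ¬ LogConcavePoly q := by
  obtain ⟨i, hi, hd, hlt⟩ := h
  intro hlc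
  exact absurd (hlc i hi hd.le) (not_le.2 hlt)

theorem natDegree_armPoly_and_monic (n : ℕ) :
    (armPoly n).natDegree = n + 1 ∧ (armPoly n).Monic := by
  have h1 : (armPoly n).coeff (n + 1) = 1 := by simp [coeff_armPoly_succ]
  have h2 : (armPoly n).natDegree ≤ n + 1 := by
    rw [natDegree_le_iff_coeff_eq_zero]
    intro i hi
    obtain ⟨j, rfl⟩ := Nat.exists_eq_add_of_lt hi
    simp [coeff_armPoly_succ, Nat.choose_eq_zero_of_lt (show n < n + 1 + j + 1 by omega),
      Nat.choose_eq_zero_of_lt (show n < n + 1 + j by omega)]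
  exact ⟨natDegree_eq_of_le_of_coeff_ne_zero h2 (by simp [h1]),
    monic_of_natDegree_le_of_coeff_eq_one _ h2 h1⟩

theorem nextCoeff_armPoly (n : ℕ) (hn : 1 ≤ n) : (armPoly n).nextCoeff = 2 ^ n + n := by
  obtain ⟨n, rfl⟩ := Nat.exists_eq_add_of_le' hn
  rw [nextCoeff_of_natDegree_pos (by rw [(natDegree_armPoly_and_monic _).1]; omega),
    (natDegree_armPoly_and_monic _).1]
  simp [coeff_armPoly_succ]

theorem monic_one_add_X : (1 + X : ℕ[X]).Monic := by
  rw [add_comm]; simpa using monic_X_add_C (1 : ℕ)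

theorem natDegree_one_add_X : (1 + X : ℕ[X]).natDegree = 1 := by
  rw [add_comm]; simpa using natDegree_X_add_C (1 : ℕ)

theorem nextCoeff_one_add_X : (1 + X : ℕ[X]).nextCoeff = 1 := by
  rw [add_comm]; simpa using nextCoeff_X_add_C (1 : ℕ)

/-- The closed form of the independence polynomial of `U_{m+1,n}`. -/
noncomputable def klPoly (m n : ℕ) : ℕ[X] :=
  X * (1 + 2 * X) ^ (m + n + 4) + (1 + 2 * X) ^ 3 * (armPoly (m + 1) * armPoly n) +
        X * ((1 + X) ^ 4 * (armPoly m * armPoly n))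

theorem monic_dominant_part (m n : ℕ) :
    ((1 + X) ^ 4 * (armPoly m * armPoly n)).Monic :=
  (monic_one_add_X.pow 4).mul
    ((natDegree_armPoly_and_monic m).2.mul (natDegree_armPoly_and_monic n).2)

theorem natDegree_dominant_part (m n : ℕ) :
    ((1 + X) ^ 4 * (armPoly m * armPoly n)).natDegree = m + n + 6 := by
  rw [(monic_one_add_X.pow 4).natDegree_mul
    ((natDegree_armPoly_and_monic m).2.mul (natDegree_armPoly_and_monic n).2),
    (natDegree_armPoly_and_monic m).2.natDegree_mul (natDegree_armPoly_and_monic n).2,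
    monic_one_add_X.natDegree_pow, natDegree_one_add_X, (natDegree_armPoly_and_monic m).1,
    (natDegree_armPoly_and_monic n).1]
  ring

theorem nextCoeff_dominant_part (m n : ℕ) (hm : 1 ≤ m) (hn : 1 ≤ n) :
    ((1 + X) ^ 4 * (armPoly m * armPoly n)).nextCoeff = 4 + (2 ^ m + m + (2 ^ n + n)) := by
  rw [(monic_one_add_X.pow 4).nextCoeff_mul
    ((natDegree_armPoly_and_monic m).2.mul (natDegree_armPoly_and_monic n).2),
    (natDegree_armPoly_and_monic m).2.nextCoeff_mul (natDegree_armPoly_and_monic n).2,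
    monic_one_add_X.nextCoeff_pow, nextCoeff_one_add_X, nextCoeff_armPoly m hm,
    nextCoeff_armPoly n hn]
  simp

theorem natDegree_one_add_two_mul_X_pow_le (n : ℕ) : ((1 + 2 * X : ℕ[X]) ^ n).natDegree ≤ n := by
  rw [natDegree_le_iff_coeff_eq_zero]
  intro i hi
  rw [coeff_one_add_two_mul_X_pow, Nat.choose_eq_zero_of_lt hi, zero_mul]

theorem natDegree_middle_part_le (m n : ℕ) :
    ((1 + 2 * X) ^ 3 * (armPoly (m + 1) * armPoly n)).natDegree ≤ m + n + 6 := by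
  refine natDegree_mul_le.trans ?_
  have h1 := natDegree_one_add_two_mul_X_pow_le 3
  have h2 := natDegree_mul_le (p := armPoly (m + 1)) (q := armPoly n)
  rw [(natDegree_armPoly_and_monic _).1, (natDegree_armPoly_and_monic _).1] at h2
  omega

theorem coeff_middle_part (m n : ℕ) :
    ((1 + 2 * X) ^ 3 * (armPoly (m + 1) * armPoly n)).coeff (m + n + 6) = 8 := by
  have hm := natDegree_armPoly_and_monic (m + 1)
  have hn := natDegree_armPoly_and_monic n
  have h2 := hm.2.natDegree_mul hn.2
  rw [hm.1, hn.1] at h2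
  have h3 : (armPoly (m + 1) * armPoly n).coeff (m + 1 + 1 + (n + 1)) = 1 := by
    rw [← h2]
    exact hm.2.mul hn.2
  rw [show m + n + 6 = 3 + (m + 1 + 1 + (n + 1)) by ring,
    coeff_mul_add_eq_of_natDegree_le (natDegree_one_add_two_mul_X_pow_le 3) h2.le, h3,
    coeff_one_add_two_mul_X_pow]
  simp

theorem coeff_klPoly_top (m n : ℕ) : (klPoly m n).coeff (m + n + 7) = 1 := by
  have h1 : ((1 + X) ^ 4 * (armPoly m * armPoly n)).coeff (m + n + 6) = 1 := by
    rw [← natDegree_dominant_part m n]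
    exact monic_dominant_part m n
  rw [klPoly, coeff_add, coeff_add, coeff_X_mul, coeff_X_mul, h1, coeff_one_add_two_mul_X_pow,
    Nat.choose_eq_zero_of_lt (by omega),
    coeff_eq_zero_of_natDegree_lt (lt_of_le_of_lt (natDegree_middle_part_le m n) (by omega))]
  simp

theorem natDegree_klPoly (m n : ℕ) : (klPoly m n).natDegree = m + n + 7 := by
  refine natDegree_eq_of_le_of_coeff_ne_zero ?_ (by simp [coeff_klPoly_top])
  rw [natDegree_le_iff_coeff_eq_zero]
  intro i hi
  obtain ⟨j, rfl⟩ := Nat.exists_eq_add_of_lt (show 0 < i by omega)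
  rw [klPoly, coeff_add, coeff_add, coeff_X_mul, coeff_X_mul, coeff_one_add_two_mul_X_pow,
    Nat.choose_eq_zero_of_lt (by omega),
    coeff_eq_zero_of_natDegree_lt (lt_of_le_of_lt (natDegree_middle_part_le m n) (by omega)),
    coeff_eq_zero_of_natDegree_lt (by rw [natDegree_dominant_part]; omega)]
  simp

theorem coeff_klPoly_penultimate (m n : ℕ) (hm : 1 ≤ m) (hn : 1 ≤ n) :
    (klPoly m n).coeff (m + n + 6) = 12 + (2 ^ m + m + (2 ^ n + n)) := by
  have h1 : ((1 + X) ^ 4 * (armPoly m * armPoly n)).coeff (m + n + 5)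
      = 4 + (2 ^ m + m + (2 ^ n + n)) := by
    rw [← nextCoeff_dominant_part m n hm hn, nextCoeff_of_natDegree_pos
      (by rw [natDegree_dominant_part]; omega), natDegree_dominant_part]
    rfl
  rw [klPoly, coeff_add, coeff_add, coeff_X_mul, coeff_X_mul, h1, coeff_one_add_two_mul_X_pow,
    Nat.choose_eq_zero_of_lt (by omega), coeff_middle_part]
  ring

theorem two_pow_le_coeff_klPoly (m n : ℕ) : 2 ^ (m + n + 4) ≤ (klPoly m n).coeff (m + n + 5) := by
  rw [klPoly, coeff_add, coeff_add, coeff_X_mul, coeff_one_add_two_mul_X_pow, Nat.choose_self]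
  omega

theorem four_mul_add_le_two_pow (m : ℕ) (hm : 8 ≤ m) : 4 * m + 30 ≤ 2 ^ m := by
  induction m, hm using Nat.le_induction with
  | base => norm_num
  | succ m hm ih => rw [pow_succ]; omega

theorem penultimateFails_klPoly (m r : ℕ) (hr : r ≤ 2) (hm : 8 ≤ m) :
    PenultimateFails (klPoly m (m + 1 + r)) := by
  refine ⟨m + (m + 1 + r) + 6, by omega, by rw [natDegree_klPoly], ?_⟩
  rw [coeff_klPoly_top, mul_one, coeff_klPoly_penultimate _ _ (by omega) (by omega)]
  refine lt_of_lt_of_le ?_ (two_pow_le_coeff_klPoly m (m + 1 + r))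
  have h := four_mul_add_le_two_pow m hm
  have e1 : 2 ^ (m + 1 + r) = 2 ^ m * 2 ^ (r + 1) := by ring
  have e2 : 2 ^ (m + (m + 1 + r) + 4) = (2 ^ m * 2 ^ m) * 2 ^ (r + 5) := by ring
  rw [e1, e2]
  -- By `h` the linear terms total at most `M / 2`, so it suffices that `(2^(r+1) + 3/2)^2 <
  -- 2^(r+5)`, which holds for `r = 0, 1, 2`.
  generalize 2 ^ m = M at h
  interval_cases r <;> norm_num <;> nlinarith

theorem coeff_le_eval_one (q : ℕ[X]) (i : ℕ) : q.coeff i ≤ q.eval 1 := by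
  rw [eval_eq_sum_range]
  simp only [one_pow, mul_one]
  rcases Nat.lt_or_ge q.natDegree i with h | h
  · simp [coeff_eq_zero_of_natDegree_lt h]
  · exact Finset.single_le_sum (f := fun i => q.coeff i) (fun _ _ => Nat.zero_le _)
      (Finset.mem_range.2 (Nat.lt_succ_of_le h))

/-- Ratios of consecutive coefficients decrease, so a single comparison settles all earlier steps,
and in `IsPF2.falls` all later ones. -/
theorem IsPF2.rises {q : ℕ[X]} (hq : IsPF2 q) {p : ℕ} (hpos : 0 < q.coeff (p + 1))
    (h : q.coeff p ≤ q.coeff (p + 1)) : ∀ i < p + 1, q.coeff i ≤ q.coeff (i + 1) := by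
  intro i hi
  have h1 := hq i (i + 1) p (p + 1) (by omega) (by omega) (by omega)
  exact Nat.le_of_mul_le_mul_right (h1.trans (Nat.mul_le_mul_left _ h)) hpos

theorem IsPF2.falls {q : ℕ[X]} (hq : IsPF2 q) {p : ℕ} (hpos : 0 < q.coeff p)
    (h : q.coeff (p + 1) ≤ q.coeff p) : ∀ i, p ≤ i → q.coeff (i + 1) ≤ q.coeff i := by
  intro i hi
  have h1 := hq p (p + 1) i (i + 1) (by omega) (by omega) (by omega)
  exact Nat.le_of_mul_le_mul_left (h1.trans (Nat.mul_le_mul_right _ h)) hpos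

/-! ### Modes and gaps of the main terms -/

/-- The coefficient of `x ^ j` in `(1 + 2 x) ^ n`, as an integer. -/
def binTwo (n j : ℕ) : ℤ := n.choose j * 2 ^ j

theorem cast_coeff_one_add_two_mul_X_pow (n j : ℕ) :
    ((((1 + 2 * X : ℕ[X]) ^ n).coeff j : ℕ) : ℤ) = binTwo n j := by
  rw [coeff_one_add_two_mul_X_pow, binTwo]
  push_cast
  rfl

theorem binTwo_nonneg (n j : ℕ) : 0 ≤ binTwo n j := by unfold binTwo; positivity

theorem succ_mul_binTwo_succ (n j : ℕ) :
    ((j : ℤ) + 1) * binTwo n (j + 1) = 2 * ((n : ℤ) - j) * binTwo n j := by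
  unfold binTwo
  rcases Nat.lt_or_ge n j with h | h
  · simp [Nat.choose_eq_zero_of_lt h, Nat.choose_eq_zero_of_lt (show n < j + 1 by omega)]
  · have h1 := Nat.choose_succ_right_eq n j
    zify [h] at h1
    rw [pow_succ]
    linear_combination (2 * 2 ^ j) * h1

theorem sub_mul_binTwo_succ (n j : ℕ) (h : j ≤ n + 1) :
    ((n : ℤ) + 1 - j) * binTwo (n + 1) j = (n + 1) * binTwo n j := by
  unfold binTwo
  have h1 := Nat.choose_mul_succ_eq n j
  zify [h] at h1
  linear_combination (-2 ^ j) * h1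

/-- The ratio of consecutive terms is `2(n - j)/(j + 1)`, which crosses 1 at `3j + 1 = 2n`. -/
theorem binTwo_le_mode {n p : ℕ} (h1 : 2 * n ≤ 3 * p + 1) (h2 : 3 * p ≤ 2 * n + 1) (j : ℕ) :
    binTwo n j ≤ binTwo n p := by
  rcases le_total j p with h | h
  · induction h using Nat.decreasingInduction with
    | self => exact le_rfl
    | of_succ k hk ih =>
      refine le_trans ?_ ih
      have h3 := succ_mul_binTwo_succ n k
      have h4 := binTwo_nonneg n k
      have h5 : ((k : ℤ) + 1) * binTwo n k ≤ ((k : ℤ) + 1) * binTwo n (k + 1) := by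
        rw [h3]
        exact mul_le_mul_of_nonneg_right (by omega) h4
      exact le_of_mul_le_mul_left h5 (by positivity)
  · induction j, h using Nat.le_induction with
    | base => exact le_rfl
    | succ k hk ih =>
      refine le_trans ?_ ih
      have h3 := succ_mul_binTwo_succ n k
      have h4 := binTwo_nonneg n k
      have h5 : ((k : ℤ) + 1) * binTwo n (k + 1) ≤ ((k : ℤ) + 1) * binTwo n k := by
        rw [h3]
        exact mul_le_mul_of_nonneg_right (by omega) h4
      exact le_of_mul_le_mul_left h5 (by positivity)

/-- The `n + 1` coefficients of `(1 + 2x)^n` sum to `3^n`, and none exceeds the mode. -/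
theorem three_pow_le_mode {n p : ℕ} (h1 : 2 * n ≤ 3 * p + 1) (h2 : 3 * p ≤ 2 * n + 1) :
    (3 : ℤ) ^ n ≤ (n + 1) * binTwo n p := by
  have h := add_pow (2 : ℤ) 1 n
  rw [show (2 : ℤ) + 1 = 3 by norm_num] at h
  rw [h]
  refine (Finset.sum_le_card_nsmul _ _ (binTwo n p) fun j _ => ?_).trans (by simp)
  refine le_trans (le_of_eq ?_) (binTwo_le_mode h1 h2 j)
  simp [binTwo, mul_comm]

/-- The index `s + 2` is a mode. The ratio identity makes `2(n - s - 1)` times the gap equal to `2n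
- 3s - 4 ≥ 1` times the modal term, so the gap is only polynomially smaller than the mode. -/
theorem binTwo_rise_gap {n s : ℕ} (h1 : 2 * n ≤ 3 * s + 7) (h2 : 3 * s + 5 ≤ 2 * n) (hn : 20 ≤ n) :
    binTwo n (s + 2) ≤ (n + 1) * (binTwo n (s + 2) - binTwo n (s + 1)) := by
  have e := succ_mul_binTwo_succ n (s + 1)
  push_cast at e
  rw [show s + 1 + 1 = s + 2 by ring] at e
  have p2 := binTwo_nonneg n (s + 2)
  zify at h1 h2 hn
  have hm : binTwo n (s + 1) ≤ binTwo n (s + 2) := binTwo_le_mode (by omega) (by omega) _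
  have k1 : binTwo n (s + 2) ≤ 2 * ((n : ℤ) - s - 1) * (binTwo n (s + 2) - binTwo n (s + 1)) := by
    nlinarith
  have k2 : 2 * ((n : ℤ) - s - 1) * (binTwo n (s + 2) - binTwo n (s + 1)) ≤
      (n + 1) * (binTwo n (s + 2) - binTwo n (s + 1)) :=
    mul_le_mul_of_nonneg_right (by linarith) (by linarith)
  linarith

theorem binTwo_fall_gap {n s : ℕ} (h1 : 2 * n ≤ 3 * s + 7) (h2 : 3 * s + 5 ≤ 2 * n) (hn : 20 ≤ n) :
    binTwo n (s + 2) ≤ (n + 1) * (binTwo n (s + 3) - binTwo n (s + 4)) := by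
  have e := succ_mul_binTwo_succ n (s + 2)
  have e' := succ_mul_binTwo_succ n (s + 3)
  push_cast at e e'
  rw [show s + 2 + 1 = s + 3 by ring] at e
  rw [show s + 3 + 1 = s + 4 by ring] at e'
  have p2 := binTwo_nonneg n (s + 2)
  have p3 := binTwo_nonneg n (s + 3)
  zify at h1 h2 hn
  -- The factor 3 is available because `s + 4` times the gap is `3s + 10 - 2n ≥ 3` times the term at
  -- `s + 3`.
  have k3 : binTwo n (s + 2) ≤ 3 * binTwo n (s + 3) := by
    refine le_of_mul_le_mul_left (a := (s : ℤ) + 3) ?_ (by positivity)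
    nlinarith
  have k1 : 3 * binTwo n (s + 3) ≤ (s + 4) * (binTwo n (s + 3) - binTwo n (s + 4)) := by
    nlinarith
  have k0 : 0 ≤ binTwo n (s + 3) - binTwo n (s + 4) :=
    nonneg_of_mul_nonneg_right (a := (s : ℤ) + 4) (by linarith) (by positivity)
  have k2 : ((s : ℤ) + 4) * (binTwo n (s + 3) - binTwo n (s + 4)) ≤
      (n + 1) * (binTwo n (s + 3) - binTwo n (s + 4)) :=
    mul_le_mul_of_nonneg_right (by linarith) k0
  linarith

/-- Sixteen times the coefficient of `x ^ j` in `(1 + x) ^ 4 * (1 + 2 x) ^ n`. -/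
def binMix (n j : ℕ) : ℤ :=
  binTwo (n + 4) j + 4 * binTwo (n + 3) j + 6 * binTwo (n + 2) j + 4 * binTwo (n + 1) j +
    binTwo n j

/-- Expand `(2(1 + x))^4 = ((1 + 2x) + 1)^4` by the binomial theorem. -/
theorem sixteen_mul_coeff (n j : ℕ) :
    16 * ((((1 + X) ^ 4 * (1 + 2 * X : ℕ[X]) ^ n).coeff j : ℕ) : ℤ) = binMix n j := by
  have h : (16 : ℕ) • ((1 + X) ^ 4 * (1 + 2 * X : ℕ[X]) ^ n) =
      (1 + 2 * X) ^ (n + 4) + 4 • (1 + 2 * X) ^ (n + 3) + 6 • (1 + 2 * X) ^ (n + 2) +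
        4 • (1 + 2 * X) ^ (n + 1) + (1 + 2 * X) ^ n := by
    simp only [nsmul_eq_mul]
    push_cast
    ring
  have h2 := congrArg (fun q : ℕ[X] => ((q.coeff j : ℕ) : ℤ)) h
  simp only [coeff_add, coeff_smul, smul_eq_mul] at h2
  push_cast [cast_coeff_one_add_two_mul_X_pow] at h2
  rw [h2, binMix]

theorem two_mul_binTwo_le {n j : ℕ} (h : n + 1 ≤ 2 * j) (hj : j ≤ n + 1) :
    2 * binTwo n j ≤ binTwo (n + 1) j := by
  have e := sub_mul_binTwo_succ n j hj
  have p := binTwo_nonneg (n + 1) j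
  zify at h hj
  refine le_of_mul_le_mul_left (a := (n : ℤ) + 1) ?_ (by positivity)
  nlinarith

theorem succ_mul_binTwo_sub (n j : ℕ) :
    ((j : ℤ) + 1) * (binTwo n (j + 1) - binTwo n j) = (2 * n - 3 * j - 1) * binTwo n j := by
  have := succ_mul_binTwo_succ n j
  linear_combination this

theorem binMix_rise_gap {n s : ℕ} (h1 : 2 * n + 1 ≤ 3 * s) (h2 : 3 * s ≤ 2 * n + 3) (hn : 46 ≤ n) :
    binTwo (n + 4) (s + 2) ≤ (n + 5) * (binMix n (s + 1) - binMix n s) := by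
  have d0 := succ_mul_binTwo_sub (n + 4) s
  have d1 := succ_mul_binTwo_sub (n + 3) s
  have d2 := succ_mul_binTwo_sub (n + 2) s
  have d3 := succ_mul_binTwo_sub (n + 1) s
  have d4 := succ_mul_binTwo_sub n s
  have q0 : 2 * binTwo (n + 3) s ≤ binTwo (n + 4) s :=
    two_mul_binTwo_le (by omega) (by omega)
  have q1 : 2 * binTwo (n + 2) s ≤ binTwo (n + 3) s :=
    two_mul_binTwo_le (by omega) (by omega)
  have q2 : 2 * binTwo (n + 1) s ≤ binTwo (n + 2) s :=
    two_mul_binTwo_le (by omega) (by omega)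
  have q3 : 2 * binTwo n s ≤ binTwo (n + 1) s := two_mul_binTwo_le (by omega) (by omega)
  have p4 := binTwo_nonneg n s
  have e1 := succ_mul_binTwo_succ (n + 4) s
  have e2 := succ_mul_binTwo_succ (n + 4) (s + 1)
  have h0 : 0 ≤ binTwo (n + 4) s := binTwo_nonneg _ _
  push_cast at d0 d1 d2 d3 d4 e1 e2
  rw [show s + 1 + 1 = s + 2 by ring] at e2
  have hB : binTwo (n + 4) (s + 2) ≤ 2 * binTwo (n + 4) s := by
    refine le_of_mul_le_mul_left (a := ((s : ℤ) + 1) * (s + 2)) ?_ (by positivity)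
    have e3 : ((s : ℤ) + 1) * (s + 2) * binTwo (n + 4) (s + 2) =
        4 * (n + 4 - s) * (n + 3 - s) * binTwo (n + 4) s := by
      linear_combination ((s : ℤ) + 1) * e2 + 2 * ((n : ℤ) + 4 - (s + 1)) * e1
    rw [e3, ← mul_assoc]
    refine mul_le_mul_of_nonneg_right ?_ h0
    zify at h1 h2 hn
    nlinarith
  have hG : 3 * binTwo (n + 4) s ≤ (s + 1) * (binMix n (s + 1) - binMix n s) := by
    have e : ((s : ℤ) + 1) * (binMix n (s + 1) - binMix n s) =
        (2 * (n + 4) - 3 * s - 1) * binTwo (n + 4) s +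
        4 * ((2 * (n + 3) - 3 * s - 1) * binTwo (n + 3) s) +
        6 * ((2 * (n + 2) - 3 * s - 1) * binTwo (n + 2) s) +
        4 * ((2 * (n + 1) - 3 * s - 1) * binTwo (n + 1) s) +
        (2 * n - 3 * s - 1) * binTwo n s := by
      unfold binMix
      linear_combination d0 + 4 * d1 + 6 * d2 + 4 * d3 + d4
    rw [e]
    have : (3 * s : ℤ) = 2 * n + 1 ∨ (3 * s : ℤ) = 2 * n + 2 ∨ (3 * s : ℤ) = 2 * n + 3 := by omega
    clear e d0 d1 d2 d3 d4 e1 e2 hB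
    generalize binTwo (n + 4) s = x₀ at *
    generalize binTwo (n + 3) s = x₁ at *
    generalize binTwo (n + 2) s = x₂ at *
    generalize binTwo (n + 1) s = x₃ at *
    generalize binTwo n s = x₄ at *
    -- The lower powers of `1 + 2x` peak earlier and may already be falling at `s`; since their
    -- coefficients at least halve with each drop of the exponent, the higher powers outweigh them.
    rcases this with h | h | h <;> rw [h] <;> ring_nf <;> linarith
  have k0 : 0 ≤ binMix n (s + 1) - binMix n s :=
    nonneg_of_mul_nonneg_right (a := (s : ℤ) + 1) (by linarith) (by positivity)
  have k2 : ((s : ℤ) + 1) * (binMix n (s + 1) - binMix n s) ≤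
      (n + 5) * (binMix n (s + 1) - binMix n s) :=
    mul_le_mul_of_nonneg_right (by omega) k0
  linarith

theorem binMix_fall_gap {n s : ℕ} (h1 : 2 * n + 1 ≤ 3 * s) (h2 : 3 * s ≤ 2 * n + 3) (hn : 46 ≤ n) :
    binTwo (n + 4) (s + 2) ≤ (n + 5) * (binMix n (s + 2) - binMix n (s + 3)) := by
  have d0 := succ_mul_binTwo_sub (n + 4) (s + 2)
  have d1 := succ_mul_binTwo_sub (n + 3) (s + 2)
  have d2 := succ_mul_binTwo_sub (n + 2) (s + 2)
  have d3 := succ_mul_binTwo_sub (n + 1) (s + 2)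
  have d4 := succ_mul_binTwo_sub n (s + 2)
  have p0 := binTwo_nonneg (n + 4) (s + 2)
  have p1 := binTwo_nonneg (n + 3) (s + 2)
  have p2 := binTwo_nonneg (n + 2) (s + 2)
  have p3 := binTwo_nonneg (n + 1) (s + 2)
  have p4 := binTwo_nonneg n (s + 2)
  have e1 := sub_mul_binTwo_succ (n + 3) (s + 2) (by omega)
  push_cast at d0 d1 d2 d3 d4 e1
  rw [show s + 2 + 1 = s + 3 by ring] at d0 d1 d2 d3 d4
  rw [show n + 3 + 1 = n + 4 by ring] at e1
  have hB : binTwo (n + 4) (s + 2) ≤ 8 * binTwo (n + 3) (s + 2) := by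
    refine le_of_mul_le_mul_left (a := (n : ℤ) + 4) ?_ (by positivity)
    have e2 : ((n : ℤ) + 4) * (8 * binTwo (n + 3) (s + 2)) =
        (8 * ((n : ℤ) + 2 - s)) * binTwo (n + 4) (s + 2) := by
      linear_combination (-8) * e1
    rw [e2]
    exact mul_le_mul_of_nonneg_right (by omega) p0
  -- If `3s = 2n + 1`, the weight of the top power is `0`; the drop is then read off the next power,
  -- whose weight is exactly 8.
  have hG : 8 * binTwo (n + 3) (s + 2) ≤ (s + 3) * (binMix n (s + 2) - binMix n (s + 3)) := by
    have e : ((s : ℤ) + 3) * (binMix n (s + 2) - binMix n (s + 3)) =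
        (3 * s + 7 - 2 * (n + 4)) * binTwo (n + 4) (s + 2) +
        4 * ((3 * s + 7 - 2 * (n + 3)) * binTwo (n + 3) (s + 2)) +
        6 * ((3 * s + 7 - 2 * (n + 2)) * binTwo (n + 2) (s + 2)) +
        4 * ((3 * s + 7 - 2 * (n + 1)) * binTwo (n + 1) (s + 2)) +
        (3 * s + 7 - 2 * n) * binTwo n (s + 2) := by
      unfold binMix
      linear_combination -d0 - 4 * d1 - 6 * d2 - 4 * d3 - d4
    rw [e]
    have : (3 * s : ℤ) = 2 * n + 1 ∨ (3 * s : ℤ) = 2 * n + 2 ∨ (3 * s : ℤ) = 2 * n + 3 := by omega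
    clear e d0 d1 d2 d3 d4 e1 hB
    generalize binTwo (n + 4) (s + 2) = x₀ at *
    generalize binTwo (n + 3) (s + 2) = x₁ at *
    generalize binTwo (n + 2) (s + 2) = x₂ at *
    generalize binTwo (n + 1) (s + 2) = x₃ at *
    generalize binTwo n (s + 2) = x₄ at *
    rcases this with h | h | h <;> rw [h] <;> ring_nf <;> linarith
  have k0 : 0 ≤ binMix n (s + 2) - binMix n (s + 3) :=
    nonneg_of_mul_nonneg_right (a := (s : ℤ) + 3) (by linarith) (by positivity)
  have k2 : ((s : ℤ) + 3) * (binMix n (s + 2) - binMix n (s + 3)) ≤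
      (n + 5) * (binMix n (s + 2) - binMix n (s + 3)) :=
    mul_le_mul_of_nonneg_right (by omega) k0
  linarith

/-! ### Small parameters by computation -/

/-- Each coefficient is at most the value at `1`, hence below `B`, so evaluation at `B` produces no
carries. All coefficients can thus be read off one integer. -/
theorem coeff_eq_digit {q : ℕ[X]} {B : ℕ} (hB : q.eval 1 < B) (i : ℕ) :
    q.coeff i = q.eval B / B ^ i % B := by
  have key : ∀ (i : ℕ) (q : ℕ[X]), (∀ j, q.coeff j < B) → q.coeff i = q.eval B / B ^ i % B := by
    intro i
    induction i with
    | zero =>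
      intro q hq
      have h := congrArg (eval B) (divX_mul_X_add q)
      simp only [eval_add, eval_mul, eval_X, eval_C] at h
      rw [pow_zero, Nat.div_one, ← h, Nat.mul_add_mod_of_lt (hq 0)]
    | succ i ih =>
      intro q hq
      have h := congrArg (eval B) (divX_mul_X_add q)
      simp only [eval_add, eval_mul, eval_X, eval_C] at h
      have hd : q.eval B / B = q.divX.eval B := by
        rw [← h, mul_comm, Nat.mul_add_div (by have := hq 0; omega), Nat.div_eq_of_lt (hq 0),
          add_zero]
      rw [pow_succ', ← Nat.div_div_eq_div_mul, hd, ← ih q.divX fun j => by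
        rw [coeff_divX]; exact hq _, coeff_divX]
  exact key i q fun j => (coeff_le_eval_one q j).trans_lt hB

/-- The value at `B` of the independence polynomial of `U_{m+1,n}`. -/
def klValue (B m n : ℕ) : ℕ :=
  B * (1 + 2 * B) ^ (m + n + 4) + (1 + 2 * B) ^ 3 *
      (((1 + 2 * B) ^ (m + 1) + B * (1 + B) ^ (m + 1)) * ((1 + 2 * B) ^ n + B * (1 + B) ^ n)) +
    B * ((1 + B) ^ 4 * (((1 + 2 * B) ^ m + B * (1 + B) ^ m) * ((1 + 2 * B) ^ n + B * (1 + B) ^ n)))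

theorem eval_klPoly (B m n : ℕ) : (klPoly m n).eval B = klValue B m n := by
  simp [klPoly, klValue, armPoly]

/-- The digit in position `i` of the value of the independence polynomial in base `2 ^ 128`. -/
def klDigit (m n i : ℕ) : ℕ := klValue (2 ^ 128) m n / (2 ^ 128) ^ i % 2 ^ 128

theorem klDigit_small : ∀ m ∈ List.range 27, ∀ r ∈ List.range 3, 2 ≤ m → (r = 2 → 3 ≤ m) →
    klValue 1 m (m + 1 + r) < 2 ^ 128 ∧
    (∀ i ∈ List.range ((4 * m + 2 * r + 11) / 3),
      klDigit m (m + 1 + r) i ≤ klDigit m (m + 1 + r) (i + 1)) ∧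
    (∀ i ∈ List.range (2 * m + r + 8), (4 * m + 2 * r + 11) / 3 < i →
      klDigit m (m + 1 + r) (i + 1) ≤ klDigit m (m + 1 + r) i) ∧
    klDigit m (m + 1 + r) (2 * m + r + 7) ^ 2 <
      klDigit m (m + 1 + r) (2 * m + r + 6) * klDigit m (m + 1 + r) (2 * m + r + 8) := by
  -- The peak index `(4 * m + 2 * r + 11) / 3` is `(2N + 1)/3` with `N = 2m + r + 5`, as for large
  -- parameters.
  decide +kernel

theorem klPoly_small (m r : ℕ) (hr : r ≤ 2) (hm : 2 ≤ m) (hm' : m < 27) (hmr : r = 2 → 3 ≤ m) :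
    UnimodalPoly (klPoly m (m + 1 + r)) ∧ PenultimateFails (klPoly m (m + 1 + r)) := by
  obtain ⟨h1, h2, h3, h4⟩ := klDigit_small m (List.mem_range.2 hm') r
    (List.mem_range.2 (by omega)) hm hmr
  have hc : ∀ i, klDigit m (m + 1 + r) i = (klPoly m (m + 1 + r)).coeff i := by
    intro i
    rw [coeff_eq_digit (B := 2 ^ 128) (by rwa [eval_klPoly]) i, eval_klPoly, klDigit]
  simp only [hc] at h2 h3 h4
  have hd : (klPoly m (m + 1 + r)).natDegree = 2 * m + r + 8 := by
    rw [natDegree_klPoly]; ring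
  constructor
  · refine UnimodalPoly.of_peak (p := (4 * m + 2 * r + 11) / 3) (by omega) ?_ ?_
    · intro i hi
      exact h2 i (List.mem_range.2 hi)
    · intro i hi
      rcases Nat.lt_or_ge i (2 * m + r + 8) with h | h
      · exact h3 i (List.mem_range.2 h) hi
      · rw [coeff_eq_zero_of_natDegree_lt (by omega)]
        exact Nat.zero_le _
  · exact ⟨2 * m + r + 7, by omega, by omega, h4⟩

/-! ### Large parameters: remainders against gaps -/

theorem sq_mul_two_pow_le_three_pow (k : ℕ) (hk : 28 ≤ k) :
    10 * (2 * k + 6) ^ 2 * 2 ^ k ≤ 3 ^ k := by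
  induction k, hk using Nat.le_induction with
  | base => norm_num
  | succ k hk ih =>
    have h : 2 * (10 * (2 * (k + 1) + 6) ^ 2) ≤ 3 * (10 * (2 * k + 6) ^ 2) := by nlinarith
    calc 10 * (2 * (k + 1) + 6) ^ 2 * 2 ^ (k + 1)
        = 2 * (10 * (2 * (k + 1) + 6) ^ 2) * 2 ^ k := by ring
      _ ≤ 3 * (10 * (2 * k + 6) ^ 2) * 2 ^ k := Nat.mul_le_mul_right _ h
      _ = 3 * (10 * (2 * k + 6) ^ 2 * 2 ^ k) := by ring
      _ ≤ 3 * 3 ^ k := Nat.mul_le_mul_left _ ih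
      _ = 3 ^ (k + 1) := by ring

/-- Here `S = (N + 1)^2`. Every remainder term has `2` in place of `3` in at least one exponential
factor. The constant 10 leaves room for three such terms, including the harder comparison of `16 *
16` with `81` in `sq_mul_dominantRest_le`. -/
theorem ten_sq_mul_two_pow_le (m r S : ℕ) (hr : r ≤ 2) (hm : 27 ≤ m)
    (hS : S = (m + (m + 1 + r) + 5) ^ 2) :
    10 * S * 2 ^ (m + 1) ≤ 3 ^ (m + 1) ∧ 10 * S * 2 ^ (m + 1 + r) ≤ 3 ^ (m + 1 + r) := by
  have h := sq_mul_two_pow_le_three_pow (m + 1) (by omega)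
  have hS' : S ≤ (2 * (m + 1) + 6) ^ 2 := by
    rw [hS]
    exact Nat.pow_le_pow_left (by omega) 2
  have h1 : 10 * S * 2 ^ (m + 1) ≤ 3 ^ (m + 1) :=
    le_trans (Nat.mul_le_mul_right _ (Nat.mul_le_mul_left _ hS')) h
  refine ⟨h1, ?_⟩
  rw [pow_add 2, pow_add 3, ← mul_assoc]
  exact Nat.mul_le_mul h1 (Nat.pow_le_pow_left (by norm_num) r)

/-- The lower-order part of `(1 + 2 x) ^ 3 * armPoly (m + 1) * armPoly n`. -/
noncomputable def middleRest (m n : ℕ) : ℕ[X] :=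
  (1 + 2 * X) ^ 3 * ((1 + 2 * X) ^ (m + 1) * (X * (1 + X) ^ n) +
    X * (1 + X) ^ (m + 1) * (1 + 2 * X) ^ n + X * (1 + X) ^ (m + 1) * (X * (1 + X) ^ n))

theorem middle_part_eq (m n : ℕ) : (1 + 2 * X) ^ 3 * (armPoly (m + 1) * armPoly n) =
    (1 + 2 * X) ^ (m + n + 4) + middleRest m n := by
  unfold armPoly middleRest
  ring

theorem eval_middleRest (m n : ℕ) : (middleRest m n).eval 1 =
    27 * (3 ^ (m + 1) * 2 ^ n + 2 ^ (m + 1) * 3 ^ n + 2 ^ (m + 1) * 2 ^ n) := by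
  simp [middleRest]

/-- The lower-order part of `(1 + x) ^ 4 * armPoly m * armPoly n`. -/
noncomputable def dominantRest (m n : ℕ) : ℕ[X] :=
  (1 + X) ^ 4 * ((1 + 2 * X) ^ m * (X * (1 + X) ^ n) +
    X * (1 + X) ^ m * (1 + 2 * X) ^ n + X * (1 + X) ^ m * (X * (1 + X) ^ n))

theorem dominant_part_eq (m n : ℕ) : (1 + X) ^ 4 * (armPoly m * armPoly n) =
    (1 + X) ^ 4 * (1 + 2 * X) ^ (m + n) + dominantRest m n := by
  unfold armPoly dominantRest
  ring

theorem eval_dominantRest (m n : ℕ) : (dominantRest m n).eval 1 =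
    16 * (3 ^ m * 2 ^ n + 2 ^ m * 3 ^ n + 2 ^ m * 2 ^ n) := by
  simp [dominantRest]

theorem sq_mul_middleRest_le (m r : ℕ) (hr : r ≤ 2) (hm : 27 ≤ m) :
    (m + (m + 1 + r) + 5) ^ 2 * (middleRest m (m + 1 + r)).eval 1 ≤
      3 ^ (m + (m + 1 + r) + 4) := by
  obtain ⟨h1, h2⟩ := ten_sq_mul_two_pow_le m r _ hr hm rfl
  rw [eval_middleRest, show 3 ^ (m + (m + 1 + r) + 4) = 27 * (3 ^ (m + 1) * 3 ^ (m + 1 + r)) by ring]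
  have hS : 1 ≤ (m + (m + 1 + r) + 5) ^ 2 := Nat.one_le_pow _ _ (by omega)
  generalize (m + (m + 1 + r) + 5) ^ 2 = S at *
  generalize 2 ^ (m + 1 + r) = b at *
  generalize 3 ^ (m + 1 + r) = B at *
  generalize 2 ^ (m + 1) = a at *
  generalize 3 ^ (m + 1) = A at *
  have k1 := Nat.mul_le_mul_left A h2
  have k2 := Nat.mul_le_mul_right B h1
  have k3 : 10 * S * (a * b) ≤ A * B := by
    calc 10 * S * (a * b) = 10 * S * a * b := by ring
      _ ≤ A * B := Nat.mul_le_mul h1 (by nlinarith)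
  nlinarith

theorem sq_mul_dominantRest_le (m r : ℕ) (hr : r ≤ 2) (hm : 27 ≤ m) :
    16 * (m + (m + 1 + r) + 5) ^ 2 * (dominantRest m (m + 1 + r)).eval 1 ≤
      3 ^ (m + (m + 1 + r) + 4) := by
  obtain ⟨h1, h2⟩ := ten_sq_mul_two_pow_le m r _ hr hm rfl
  rw [eval_dominantRest, show 3 ^ (m + (m + 1 + r) + 4) = 81 * (3 ^ m * 3 ^ (m + 1 + r)) by ring]
  have hS : 1 ≤ (m + (m + 1 + r) + 5) ^ 2 := Nat.one_le_pow _ _ (by omega)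
  generalize (m + (m + 1 + r) + 5) ^ 2 = S at *
  generalize 2 ^ (m + 1 + r) = b at *
  generalize 3 ^ (m + 1 + r) = B at *
  rw [pow_succ, pow_succ] at h1
  generalize 2 ^ m = a at *
  generalize 3 ^ m = A at *
  have k1 := Nat.mul_le_mul_left A h2
  have k2 := Nat.mul_le_mul_right B h1
  have k3 : 10 * S * (20 * (a * b)) ≤ 3 * (A * B) := by
    calc 10 * S * (20 * (a * b)) = 10 * S * (a * 2) * (10 * b) := by ring
      _ ≤ (A * 3) * B := Nat.mul_le_mul h1 (by nlinarith)
      _ = 3 * (A * B) := by ring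
  nlinarith

/-- A gap of at least `3 ^ N / (c * (N + 1) ^ 2)` absorbs a perturbation below that bound. -/
theorem add_le_of_gap {x y t : ℤ} {c N e : ℕ} (hc : 0 < c)
    (hmode : (3 : ℤ) ^ N ≤ (N + 1) * t) (hgap : t ≤ (N + 1) * (c * (y - x)))
    (he : c * (N + 1) ^ 2 * e ≤ 3 ^ N) : x + e ≤ y := by
  have he' : ((c * (N + 1) ^ 2 * e : ℕ) : ℤ) ≤ 3 ^ N := by exact_mod_cast he
  have h1 : ((c : ℤ) * (N + 1) ^ 2) * e ≤ (c * (N + 1) ^ 2) * (y - x) := by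
    push_cast at he'
    have : ((N : ℤ) + 1) * t ≤ (N + 1) * ((N + 1) * (c * (y - x))) :=
      mul_le_mul_of_nonneg_left hgap (by positivity)
    nlinarith
  have := le_of_mul_le_mul_left h1 (by positivity)
  linarith

theorem unimodalPoly_klPoly (m r : ℕ) (hr : r ≤ 2) (hm : 27 ≤ m) :
    UnimodalPoly (klPoly m (m + 1 + r)) := by
  set n := m + 1 + r with hn
  set N := m + n + 4 with hN
  -- Thus `s + 2` is the integer part of `(2N + 1)/3`, a mode of `(1 + 2X)^N`.
  obtain ⟨s, hs1, hs2⟩ : ∃ s, 2 * N ≤ 3 * s + 7 ∧ 3 * s + 5 ≤ 2 * N :=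
    ⟨(2 * N + 1) / 3 - 2, by omega, by omega⟩
  have hmode : (3 : ℤ) ^ N ≤ (N + 1) * binTwo N (s + 2) := three_pow_le_mode (by omega) (by omega)
  have hpos : 0 < binTwo N (s + 2) := by
    refine pos_of_mul_pos_right (a := (N : ℤ) + 1) (lt_of_lt_of_le (by positivity) hmode)
      (by positivity)
  -- The factor `X` moves this mode to `s + 3`. Only the step from `s + 2` to `s + 3` stays
  -- uncontrolled, here and in the other two summands.
  have first : (∀ i < s + 2, (X * (1 + 2 * X : ℕ[X]) ^ N).coeff i ≤
      (X * (1 + 2 * X : ℕ[X]) ^ N).coeff (i + 1)) ∧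
      ∀ i, s + 2 < i → (X * (1 + 2 * X : ℕ[X]) ^ N).coeff (i + 1) ≤
        (X * (1 + 2 * X : ℕ[X]) ^ N).coeff i := by
    have hPF : IsPF2 (X * (1 + 2 * X : ℕ[X]) ^ N) := (IsPF2.one_add_two_mul_X.pow N).X_mul
    have hcoef : ∀ j, 0 < (X * (1 + 2 * X : ℕ[X]) ^ N).coeff (j + 1) ↔ 0 < binTwo N j := by
      intro j
      rw [coeff_X_mul, ← cast_coeff_one_add_two_mul_X_pow]
      exact Nat.cast_pos.symm
    have hle : ∀ i j, binTwo N i ≤ binTwo N j → (X * (1 + 2 * X : ℕ[X]) ^ N).coeff (i + 1) ≤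
        (X * (1 + 2 * X : ℕ[X]) ^ N).coeff (j + 1) := by
      intro i j h
      rw [← cast_coeff_one_add_two_mul_X_pow, ← cast_coeff_one_add_two_mul_X_pow] at h
      rw [coeff_X_mul, coeff_X_mul]
      exact_mod_cast h
    have d := succ_mul_binTwo_sub N s
    have d' := binTwo_nonneg N s
    have p1 : binTwo N s ≤ binTwo N (s + 1) := by
      have : 0 ≤ ((s : ℤ) + 1) * (binTwo N (s + 1) - binTwo N s) := by
        rw [d]; exact mul_nonneg (by omega) d'
      linarith [nonneg_of_mul_nonneg_right this (by positivity)]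
    have p2 : 0 < binTwo N (s + 1) := by
      unfold binTwo
      have := Nat.choose_pos (show s + 1 ≤ N by omega)
      positivity
    constructor
    · exact hPF.rises ((hcoef _).2 p2) (hle _ _ p1)
    · intro i hi
      exact hPF.falls ((hcoef (s + 2)).2 hpos)
        (hle _ _ (binTwo_le_mode (by omega) (by omega) _)) i hi
  have second : (∀ i < s + 2, ((1 + 2 * X) ^ 3 * (armPoly (m + 1) * armPoly n)).coeff i ≤
      ((1 + 2 * X) ^ 3 * (armPoly (m + 1) * armPoly n)).coeff (i + 1)) ∧
      ∀ i, s + 2 < i → ((1 + 2 * X) ^ 3 * (armPoly (m + 1) * armPoly n)).coeff (i + 1) ≤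
        ((1 + 2 * X) ^ 3 * (armPoly (m + 1) * armPoly n)).coeff i := by
    have hPF : IsPF2 ((1 + 2 * X) ^ 3 * (armPoly (m + 1) * armPoly n)) :=
      (IsPF2.one_add_two_mul_X.pow 3).mul ((isPF2_armPoly _).mul (isPF2_armPoly _))
    rw [middle_part_eq] at hPF ⊢
    have he : 1 * (N + 1) ^ 2 * (middleRest m n).eval 1 ≤ 3 ^ N := by
      rw [one_mul]; exact sq_mul_middleRest_le m r hr hm
    have hle : ∀ i j, binTwo N i + ((middleRest m n).eval 1 : ℕ) ≤ binTwo N j →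
        ((1 + 2 * X) ^ N + middleRest m n).coeff i ≤
          ((1 + 2 * X) ^ N + middleRest m n).coeff j := by
      intro i j h
      rw [← cast_coeff_one_add_two_mul_X_pow, ← cast_coeff_one_add_two_mul_X_pow] at h
      have h' := Int.ofNat_le.1 (by exact_mod_cast h)
      rw [coeff_add, coeff_add]
      have := coeff_le_eval_one (middleRest m n) i
      omega
    have hge : ∀ j, 0 < binTwo N j → 0 < ((1 + 2 * X) ^ N + middleRest m n).coeff j := by
      intro j h
      rw [← cast_coeff_one_add_two_mul_X_pow] at h
      rw [coeff_add]
      have := Nat.cast_pos.1 h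
      omega
    constructor
    · refine hPF.rises (hge _ hpos) (hle _ _ ?_)
      refine add_le_of_gap (by norm_num) hmode ?_ he
      simpa using binTwo_rise_gap hs1 hs2 (by omega)
    · intro i hi
      refine hPF.falls (p := s + 3) (hge _ ?_) (hle _ _ ?_) i hi
      · unfold binTwo
        have := Nat.choose_pos (show s + 3 ≤ N by omega)
        positivity
      · refine add_le_of_gap (by norm_num) hmode ?_ he
        simpa using binTwo_fall_gap hs1 hs2 (by omega)
  have third : (∀ i < s + 2, (X * ((1 + X) ^ 4 * (armPoly m * armPoly n))).coeff i ≤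
      (X * ((1 + X) ^ 4 * (armPoly m * armPoly n))).coeff (i + 1)) ∧
      ∀ i, s + 2 < i → (X * ((1 + X) ^ 4 * (armPoly m * armPoly n))).coeff (i + 1) ≤
        (X * ((1 + X) ^ 4 * (armPoly m * armPoly n))).coeff i := by
    have hPF : IsPF2 (X * ((1 + X) ^ 4 * (armPoly m * armPoly n))) :=
      ((IsPF2.one_add_X.pow 4).mul ((isPF2_armPoly _).mul (isPF2_armPoly _))).X_mul
    rw [dominant_part_eq] at hPF ⊢
    set Q : ℕ[X] := (1 + X) ^ 4 * (1 + 2 * X) ^ (m + n) with hQ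
    have he : 16 * (N + 1) ^ 2 * (dominantRest m n).eval 1 ≤ 3 ^ N :=
      sq_mul_dominantRest_le m r hr hm
    have hle : ∀ i j, (Q.coeff i : ℤ) + ((dominantRest m n).eval 1 : ℕ) ≤ Q.coeff j →
        (X * (Q + dominantRest m n)).coeff (i + 1) ≤ (X * (Q + dominantRest m n)).coeff (j + 1) := by
      intro i j h
      have h' := Int.ofNat_le.1 (by exact_mod_cast h)
      rw [coeff_X_mul, coeff_X_mul, coeff_add, coeff_add]
      have := coeff_le_eval_one (dominantRest m n) i
      omega
    have hge : ∀ j ≤ N - 4, 0 < (X * (Q + dominantRest m n)).coeff (j + 1) := by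
      intro j hj
      have h1 := sixteen_mul_coeff (m + n) j
      have h2 : 0 < binTwo (m + n) j := by
        unfold binTwo
        have := Nat.choose_pos (show j ≤ m + n by omega)
        positivity
      have h3 := binTwo_nonneg (m + n + 1) j
      have h4 := binTwo_nonneg (m + n + 2) j
      have h5 := binTwo_nonneg (m + n + 3) j
      have h6 := binTwo_nonneg (m + n + 4) j
      rw [coeff_X_mul, coeff_add]
      rw [← hQ, binMix] at h1
      omega
    constructor
    · refine hPF.rises (hge _ (by omega)) (hle _ _ ?_)
      -- Here `c = 16`, because `binMix` is sixteen times the coefficient.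
      refine add_le_of_gap (by norm_num) hmode ?_ he
      have := binMix_rise_gap (n := m + n) (s := s) (by omega) (by omega) (by omega)
      rw [← sixteen_mul_coeff, ← sixteen_mul_coeff] at this
      push_cast [hN] at this ⊢
      linarith
    · intro i hi
      refine hPF.falls (p := s + 3) (hge _ (by omega)) (hle _ _ ?_) i hi
      refine add_le_of_gap (by norm_num) hmode ?_ he
      have := binMix_fall_gap (n := m + n) (s := s) (by omega) (by omega) (by omega)
      rw [← sixteen_mul_coeff, ← sixteen_mul_coeff] at this
      push_cast [hN] at this ⊢
      linarith
  refine UnimodalPoly.of_peak (p := s + 2) (by rw [natDegree_klPoly]; omega) ?_ ?_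
  · intro i hi
    simp only [klPoly, coeff_add]
    exact Nat.add_le_add (Nat.add_le_add (first.1 i hi) (second.1 i hi)) (third.1 i hi)
  · intro i hi
    simp only [klPoly, coeff_add]
    exact Nat.add_le_add (Nat.add_le_add (first.2 i hi) (second.2 i hi)) (third.2 i hi)

theorem mainTheorem1 (k r : ℕ) (hr : r ≤ 2) (hk : 3 ≤ k) (hk2 : r = 2 → 4 ≤ k) :
    UnimodalPoly (indepPoly (KLClosure k (k + r) (le_trans (by norm_num) hk))) ∧
      ¬ LogConcavePoly (indepPoly (KLClosure k (k + r) (le_trans (by norm_num) hk))) ∧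
      PenultimateFails (indepPoly (KLClosure k (k + r) (le_trans (by norm_num) hk))) := by
  obtain ⟨m, rfl⟩ : ∃ m, k = m + 1 := ⟨k - 1, by omega⟩
  rw [indepPoly_klClosure]
  change UnimodalPoly (klPoly m (m + 1 + r)) ∧ ¬ LogConcavePoly (klPoly m (m + 1 + r)) ∧
    PenultimateFails (klPoly m (m + 1 + r))
  have key : UnimodalPoly (klPoly m (m + 1 + r)) ∧ PenultimateFails (klPoly m (m + 1 + r)) := by
    rcases Nat.lt_or_ge m 27 with h | h
    · exact klPoly_small m r hr (by omega) h fun h => by have := hk2 h; omega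
    · exact ⟨unimodalPoly_klPoly m r hr h, penultimateFails_klPoly m r hr (by omega)⟩
  exact ⟨key.1, key.2.not_logConcavePoly, key.2⟩
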